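/- Let $1\le r\le n-2$, let $E_{a,b}$ denote the matrix units of size $2n$, and let $e_1,\dots,e_{2n}$ be the standard basis of $\mathbb C^{2n}$. Put $S=\sum_{i=1}^n(-1)^i(E_{i,2n+1-i}+E_{2n+1-i,i})$ and consider the orthogonal Lie algebra $\{X : X^{T}S+SX=0\}$ of type $D_n$ with its standard regular nilpotent element $$\Lambda=\sum_{i=1}^{n-1}(E_{i,i+1}+E_{2n-i,2n+1-i})+E_{n-1,n+1}+E_{n,n+2}.$$ For a skew-symmetric matrix $A$ of size $2n$ let $\hat A$ be its coPfaffian matrix, i.e. the skew-symmetric matrix with entries $(-1)^{i+j}\operatorname{Pf}(A^{i,j})$ for $i<j$, where $A^{i,j}$ is $A$ with the rows and columns $i,j$ removed. For complex time variables $\mathbf t=(\mathbf t',s)$, $\mathbf t'=(t_1,t_3,\dots,t_{2n-3})$, put $$\Theta(\Lambda;\mathbf t)=\sum_{k=1}^{n-1}t_{2k-1}\Lambda^{2k-1}+s\,c_n\,(\widehat{S\Lambda})^{T}S,\qquad c_n=-(-1)^{n(n+1)/2}.$$ Realize the $r$-th fundamental representation as $\bigwedge^r\mathbb C^{2n}$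 with highest weight vector $e_1\wedge\dots\wedge e_r$ and bilinear form $\langle v_1\wedge\dots\wedge v_r,\,w_1\wedge\dots\wedge w_r\rangle=\det(v_i^{T}w_j)$, and let $\tau_r(\Lambda;\mathbf t;u)=\langle e_1\wedge\dots\wedge e_r,\ \exp\Theta(\Lambda;\mathbf t)\cdot u\rangle$ for $u\in\bigwedge^r\mathbb C^{2n}$. Define $q_m(\mathbf t')$ by $\sum_{m\ge0}q_mz^m=\exp\big(\sum_{k=1}^{n-1}t_{2k-1}z^{2k-1}\big)$ and $q_m=0$ for $m<0$. For a sequence of integers $\mu=(\mu_1,\dots,\mu_l)$ with $l\le n$ put $\mu_i=0$ for $l<i\le n$ and let $S_\mu(\mathbf t')=\det(q_{\mu_i-i+j}(\mathbf t'))_{1\le i,j\le n}$ (the $2$-reduced Schur function). Let $J=\{j_1<\dots<j_r\}\subseteq\{1,\dots,2n\}$ and $e_J=e_{j_1}\wedge\dots\wedge e_{j_r}$. For $1\le k\le r$ let $\lambda_k=j_{r-k+1}-(r-k+1)-1$ if $j_{r-k+1}\ge n+1$ and $\lambda_k=j_{r-k+1}-(r-k+1)$ if $j_{r-k+1}\le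 n$. Let $\lambda=(\lambda_1,\dots,\lambda_r)$, $p=\#\{k: j_k\ge n+2\}$, $\lambda'=(\lambda_1,\dots,\lambda_p,\lambda_{p+2}-1,\dots,\lambda_r-1)$ (used only when $p<r$), and $\lambda''=(\lambda_2-1,\dots,\lambda_r-1)$. Then $\tau=\tau_r(\Lambda;\mathbf t;e_J)$ is given as follows, according to $K=J\cap\{n,n+1,2n\}$. 1. If $K=\emptyset$, then $\tau=2^pS_\lambda(\mathbf t')$. 2. If $K=\{2n\}$, then $\tau=2^pS_\lambda(\mathbf t')+(-1)^{n+r}2^{p-1}s^2S_{\lambda''}(\mathbf t')$. 3. If $K=\{n+1\}$, then $\tau=2^pS_\lambda(\mathbf t')+(-1)^{r-p+1}2^ps\,S_{\lambda'}(\mathbf t')$. 4. If $K=\{n\}$, then $\tau=2^pS_\lambda(\mathbf t')+(-1)^{r-p}2^ps\,S_{\lambda'}(\mathbf t')$. 5. If $K=\{n+1,2n\}$, then $\tau=2^pS_\lambda(\mathbf t')+(-1)^{r-p+1}2^ps\,S_{\lambda'}(\mathbf t')+(-1)^{n+r}2^{p-1}s^2S_{\lambda''}(\mathbf t')$. 6.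 If $K=\{n,2n\}$, then $\tau=2^pS_\lambda(\mathbf t')+(-1)^{r-p}2^ps\,S_{\lambda'}(\mathbf t')+(-1)^{n+r}2^{p-1}s^2S_{\lambda''}(\mathbf t')$. 7. If $K=\{n,n+1\}$, then $\tau=(-1)^{r-p+1}2^{p+1}s\,S_{\lambda'}(\mathbf t')$. 8. If $K=\{n,n+1,2n\}$, then $\tau=(-1)^{r-p+1}2^{p+1}s\,S_{\lambda'}(\mathbf t')$. (For another choice of the highest weight vector or of the invariant form, the formulas hold up to a nonzero constant.) -/

import Mathlib

noncomputable section

namespace TypeDToda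

/-! Rows and columns of `2n × 2n` matrices are numbered `1, …, 2n` in the notation below;
the row numbered `a` is the element `i : Fin (2 * n)` with `(i : ℕ) + 1 = a`. -/

/-- The matrix unit `E_{a,b}` of size `2n`, for `1 ≤ a, b ≤ 2n`. -/
def matUnit (n a b : ℕ) : Matrix (Fin (2 * n)) (Fin (2 * n)) ℂ :=
  Matrix.of fun i j => if (i : ℕ) + 1 = a ∧ (j : ℕ) + 1 = b then 1 else 0

/-- The standard basis vector `e_a` of `ℂ^{2n}`, for `1 ≤ a ≤ 2n`. -/
def stdVec (n a : ℕ) : Fin (2 * n) → ℂ :=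
  fun i => if (i : ℕ) + 1 = a then 1 else 0

/-- The symmetric matrix `S = ∑_{i=1}^n (-1)^i (E_{i,2n+1-i} + E_{2n+1-i,i})` of the form that
defines the orthogonal Lie algebra `{X | Xᵀ S + S X = 0}`. -/
def formMatrix (n : ℕ) : Matrix (Fin (2 * n)) (Fin (2 * n)) ℂ :=
  ∑ i ∈ Finset.Icc 1 n,
    (-1 : ℂ) ^ i • (matUnit n i (2 * n + 1 - i) + matUnit n (2 * n + 1 - i) i)

/-- The standard regular nilpotent element `Λ`, the sum of the simple root vectors. -/
def regNilp (n : ℕ) : Matrix (Fin (2 * n)) (Fin (2 * n)) ℂ :=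
  ∑ i ∈ Finset.Icc 1 (n - 1), (matUnit n i (i + 1) + matUnit n (2 * n - i) (2 * n + 1 - i))
    + matUnit n (n - 1) (n + 1) + matUnit n n (n + 2)

/-- The Pfaffian of a skew-symmetric matrix of size `2m`, by expansion along the first row. -/
def pfaffian : (m : ℕ) → Matrix (Fin (2 * m)) (Fin (2 * m)) ℂ → ℂ
  | 0, _ => 1
  | m + 1, A =>
      ∑ j : Fin (2 * m + 1), (-1 : ℂ) ^ (j : ℕ) * A (0 : Fin (2 * m + 2)) j.succ *
        pfaffian m (Matrix.of fun a b : Fin (2 * m) =>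
          A ((j.succAbove a).succ : Fin (2 * m + 2)) (j.succAbove b).succ)

/-- For `i < j`, the increasing enumeration of the indices different from `i` and `j`. -/
def skipTwo (n : ℕ) (i j : Fin (2 * n)) (k : Fin (2 * (n - 1))) : Fin (2 * n) :=
  ⟨if (k : ℕ) < i then k else if (k : ℕ) + 1 < j then k + 1 else k + 2, by
    have := k.isLt
    split_ifs <;> omega⟩

/-- `(-1)^{i+j}` times the Pfaffian of `A` with rows and columns `i` and `j` removed, `i < j`. -/
def coPfEntry (n : ℕ) (A : Matrix (Fin (2 * n)) (Fin (2 * n)) ℂ) (i j : Fin (2 * n)) : ℂ :=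
  (-1 : ℂ) ^ ((i : ℕ) + (j : ℕ)) *
    pfaffian (n - 1) (A.submatrix (skipTwo n i j) (skipTwo n i j))

/-- The coPfaffian matrix `Â` of a skew-symmetric matrix `A`: the skew-symmetric matrix with
entries `(-1)^{i+j} Pf(A^{i,j})` for `i < j`. -/
def coPf (n : ℕ) (A : Matrix (Fin (2 * n)) (Fin (2 * n)) ℂ) :
    Matrix (Fin (2 * n)) (Fin (2 * n)) ℂ :=
  Matrix.of fun i j =>
    if i < j then coPfEntry n A i j else if j < i then -coPfEntry n A j i else 0

/-- The constant `c_n = -(-1)^{n(n+1)/2}`. -/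
def normConst (n : ℕ) : ℂ := -(-1 : ℂ) ^ (n * (n + 1) / 2)

/-- `Θ(Λ; t) = ∑_{k=1}^{n-1} t_{2k-1} Λ^{2k-1} + s c_n (\hat{SΛ})ᵀ S`.
The time `t_{2k+1}` is `t k`, for `k = 0, …, n - 2`. -/
def Theta (n : ℕ) (t : Fin (n - 1) → ℂ) (s : ℂ) : Matrix (Fin (2 * n)) (Fin (2 * n)) ℂ :=
  ∑ k : Fin (n - 1), t k • regNilp n ^ (2 * (k : ℕ) + 1)
    + (s * normConst n) • ((coPf n (formMatrix n * regNilp n)).transpose * formMatrix n)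

/-- The bilinear form on `⋀^r ℂ^{2n}` induced by the standard form `⟨v, w⟩ = vᵀ w`. -/
def extForm (n r : ℕ) (u w : ⋀[ℂ]^r (Fin (2 * n) → ℂ)) : ℂ :=
  exteriorPower.pairingDual ℂ (Fin (2 * n) → ℂ) r
    (exteriorPower.map r (dotProductEquiv ℂ (Fin (2 * n))).toLinearMap u) w

/-- `⟨v₁ ∧ … ∧ v_r, w₁ ∧ … ∧ w_r⟩ = det (⟨v_i, w_j⟩)`. -/
theorem extForm_wedge (n r : ℕ) (v w : Fin r → Fin (2 * n) → ℂ) :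
    extForm n r (exteriorPower.ιMulti ℂ r v) (exteriorPower.ιMulti ℂ r w) =
      (Matrix.of fun i j => v i ⬝ᵥ w j).det := by
  unfold extForm
  rw [exteriorPower.map_apply_ιMulti, exteriorPower.pairingDual_ιMulti_ιMulti,
    ← Matrix.det_transpose]
  rfl

/-- `e_J = e_{j_1} ∧ … ∧ e_{j_r}`. -/
def wedgeVec (n r : ℕ) (J : Fin r → ℕ) : ⋀[ℂ]^r (Fin (2 * n) → ℂ) :=
  exteriorPower.ιMulti ℂ r fun k => stdVec n (J k)

/-- The `τ`-function `τ_r(Λ; t; u) = ⟨v_r, exp Θ(Λ; t) · u⟩` for `1 ≤ r ≤ n - 2`: the matrix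
coefficient on the fundamental representation `⋀^r ℂ^{2n}`, with highest weight vector
`v_r = e_1 ∧ … ∧ e_r`. -/
def tau (n r : ℕ) (t : Fin (n - 1) → ℂ) (s : ℂ) (u : ⋀[ℂ]^r (Fin (2 * n) → ℂ)) : ℂ :=
  extForm n r (wedgeVec n r fun k => (k : ℕ) + 1)
    (exteriorPower.map r (Matrix.toLin' (NormedSpace.exp (Theta n t s))) u)

/-- `q_m`, defined by `∑_m q_m z^m = exp (∑_{k=1}^{n-1} t_{2k-1} z^{2k-1})`,
with `q_m = 0` for `m < 0`. -/
def qPoly (n : ℕ) (t : Fin (n - 1) → ℂ) (m : ℤ) : ℂ :=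
  if 0 ≤ m then
    PowerSeries.coeff m.toNat
      ((PowerSeries.exp ℂ).subst
        (∑ k : Fin (n - 1), PowerSeries.C (t k) * PowerSeries.X ^ (2 * (k : ℕ) + 1) :
          PowerSeries ℂ))
  else 0

/-- The `2`-reduced Schur function `S_μ = det (q_{μ_i - i + j})_{1 ≤ i, j ≤ n}` of a sequence
`μ` of length `l ≤ n`, extended by zeros to length `n`. -/
def schurS (n : ℕ) (t : Fin (n - 1) → ℂ) {l : ℕ} (μ : Fin l → ℤ) : ℂ :=
  (Matrix.of fun i j : Fin n =>
    qPoly n t ((if h : (i : ℕ) < l then μ ⟨i, h⟩ else 0) - (i : ℤ) + (j : ℤ))).det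

/-- The sequence `λ_1, …, λ_r` attached to `J = (j_1 < … < j_r)`:
`λ_k = j_{r-k+1} - (r-k+1)`, diminished by one when `j_{r-k+1} ≥ n+1`. -/
def lam (n r : ℕ) (J : Fin r → ℕ) : Fin r → ℤ :=
  fun k => (J k.rev : ℤ) - ((r : ℤ) - (k : ℤ)) - (if n + 1 ≤ J k.rev then 1 else 0)

/-- `p = #{k | j_k ≥ n + 2}`. -/
def numLarge (n r : ℕ) (J : Fin r → ℕ) : ℕ :=
  (Finset.univ.filter fun k : Fin r => n + 2 ≤ J k).card

/-- `(μ_1, …, μ_p, μ_{p+2} - 1, …, μ_r - 1)`. -/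
def dropAt {r : ℕ} (p : ℕ) (μ : Fin r → ℤ) : Fin (r - 1) → ℤ :=
  fun k =>
    if (k : ℕ) < p then μ ⟨k, by have := k.isLt; omega⟩
    else μ ⟨k + 1, by have := k.isLt; omega⟩ - 1

end TypeDToda

end

/-!
The coefficient `τ_r(Λ; t; e_J)` is the minor of `exp Θ` with rows `1, …, r` and columns `J`, so it
suffices to know the rows `1, …, n - 2` of `exp Θ`.

*The coPfaffian term.* Viewed as a weighted adjacency matrix, `S Λ` has the edges `{i, 2n+2-i}` for
`2 ≤ i ≤ n` and `{n+1, n+2}`, and the vertex `1` is isolated. After the removal of two vertices a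
perfect matching is left only if these are `1` and one of `n`, `n + 1`
(`coPfEntry_formMatrix_mul_regNilp`), and then its weight is `c_n`. Hence
`Ψ = c_n (\hat{SΛ})ᵀ S` equals `E_{1,n+1} - E_{1,n} + (-1)^n (E_{n,2n} - E_{n+1,2n})`
(`copfElem_apply`), which satisfies `Λ Ψ = Ψ Λ = 0`, `Ψ² = 2 (-1)^{n+1} E_{1,2n}` and `Ψ³ = 0`.

*The exponential.* It follows that `exp Θ = ∑ q_m Λ^m + s Ψ + (s²/2) Ψ²` (`exp_Theta`). The row
vector `e₁ᵀ Λ^a` is `e_{a+1}` for `a ≤ n - 2`, then `e_n + e_{n+1}`, then `2 e_{a+2}`; in other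
words a column `j` is met for exactly one `a`, namely `d_j = colDeg n j`, with the coefficient
`colCoef n j`, which is `1` or `2`. As `e_iᵀ = e₁ᵀ Λ^{i-1}` for `i ≤ n - 2`, these rows of `exp Θ`
have the entries `colCoef n j * q_{d_j - (i-1)}`, and only the first row receives the additional
`s (e_{n+1} - e_n) + (-1)^{n+1} s² e_{2n}` (`exp_Theta_apply`).

*The minor.* By linearity in the first row, the minor is `2^p det (q_{d_j - (i-1)})` plus the
cofactors of the columns `n`, `n + 1` and `2n`, weighted by that additional vector
(`tau_eq_add_cofactorAt`). Reversing the order of rows and columns turns the determinant into the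
Jacobi–Trudi determinant of `λ` and the cofactors into those of `λ` with one part dropped
(`schurS_lam`, `schurS_dropAt_lam`). If `n` and `n + 1` both belong to `J`, then these two columns
agree outside the additional vector, so that the terms without `s` and with `s²` vanish and the two
terms linear in `s` are equal.
-/

namespace TypeDToda

open Matrix

/-! ### The regular nilpotent element -/

/-- The degree of the column `j` (numbered from `1`): the unique `a` such that `e₁ᵀ Λ^a` has a
nonzero entry in that column. -/
def colDeg (n j : ℕ) : ℤ := (j : ℤ) - 1 - (if n + 1 ≤ j then 1 else 0)

/-- The nonzero entry of `e₁ᵀ Λ^a` in the column `j`, for `a = colDeg n j`. -/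
def colCoef (n j : ℕ) : ℂ := if n + 2 ≤ j then 2 else 1

theorem colDeg_of_lt {n j : ℕ} (h : j < n) : colDeg n (j + 1) = j := by
  rw [colDeg, if_neg (by omega)]; push_cast; ring

theorem colDeg_of_ge {n j : ℕ} (h : n ≤ j) : colDeg n (j + 1) = j - 1 := by
  rw [colDeg, if_pos (by omega)]; push_cast; ring

theorem colCoef_of_le {n j : ℕ} (h : j ≤ n) : colCoef n (j + 1) = 1 := if_neg (by omega)

theorem colCoef_of_gt {n j : ℕ} (h : n < j) : colCoef n (j + 1) = 2 := if_pos (by omega)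

theorem regNilp_apply {n : ℕ} (hn : 2 ≤ n) (i j : Fin (2 * n)) :
    regNilp n i j =
      if ((i : ℕ) + 1 = j ∧ (i : ℕ) + 1 ≠ n) ∨
          ((i : ℕ) + 2 = j ∧ ((i : ℕ) + 2 = n ∨ (i : ℕ) + 1 = n)) then
        1 else 0 := by
  have h1 : ∑ a ∈ Finset.Icc 1 (n - 1), matUnit n a (a + 1) i j =
      if (i : ℕ) + 1 < n ∧ (i : ℕ) + 1 = j then 1 else 0 := by
    have : ∀ a ∈ Finset.Icc 1 (n - 1), matUnit n a (a + 1) i j =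
        if a = (i : ℕ) + 1 then (if (i : ℕ) + 1 = j then 1 else 0) else 0 := by
      intro a _
      simp only [matUnit, of_apply]
      split_ifs <;> first | rfl | omega
    rw [Finset.sum_congr rfl this, Finset.sum_ite_eq']
    simp only [Finset.mem_Icc]
    split_ifs <;> first | rfl | omega
  have h2 : ∑ a ∈ Finset.Icc 1 (n - 1), matUnit n (2 * n - a) (2 * n + 1 - a) i j =
      if n ≤ (i : ℕ) ∧ (i : ℕ) + 1 = j then 1 else 0 := by
    have : ∀ a ∈ Finset.Icc 1 (n - 1), matUnit n (2 * n - a) (2 * n + 1 - a) i j =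
        if a = 2 * n - 1 - (i : ℕ) then (if (i : ℕ) + 1 = j then 1 else 0) else 0 := by
      intro a ha
      rw [Finset.mem_Icc] at ha
      have := i.isLt
      simp only [matUnit, of_apply]
      split_ifs <;> first | rfl | omega
    rw [Finset.sum_congr rfl this, Finset.sum_ite_eq']
    simp only [Finset.mem_Icc]
    have := j.isLt
    have := i.isLt
    split_ifs <;> first | rfl | omega
  rw [regNilp, Matrix.add_apply, Matrix.add_apply, Matrix.sum_apply]
  simp only [Matrix.add_apply, Finset.sum_add_distrib]
  rw [h1, h2]
  simp only [matUnit, of_apply]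
  have := j.isLt
  split_ifs <;> first | omega | norm_num

/-- The powers of `Λ` are supported above ever higher diagonals. -/
theorem regNilp_pow_apply_eq_zero {n : ℕ} (hn : 2 ≤ n) (m : ℕ) (i j : Fin (2 * n))
    (h : (j : ℕ) < i + m) : (regNilp n ^ m) i j = 0 := by
  induction m generalizing j with
  | zero => exact one_apply_ne (by intro e; subst e; omega)
  | succ m ih =>
    rw [pow_succ, mul_apply]
    refine Finset.sum_eq_zero fun k _ => ?_
    by_cases hk : (k : ℕ) < i + m
    · rw [ih k hk, zero_mul]
    · rw [regNilp_apply hn, if_neg (by omega), mul_zero]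

theorem regNilp_pow_eq_zero {n : ℕ} (hn : 2 ≤ n) {m : ℕ} (hm : 2 * n ≤ m) : regNilp n ^ m = 0 := by
  ext i j
  exact regNilp_pow_apply_eq_zero hn m i j (by have := j.isLt; omega)

/-- The first row of the powers of `Λ`. -/
theorem regNilp_pow_zero_apply {n : ℕ} (hn : 2 ≤ n) (m : ℕ) (i j : Fin (2 * n)) (hi : (i : ℕ) = 0) :
    (regNilp n ^ m) i j = if (m : ℤ) = colDeg n (j + 1) then colCoef n (j + 1) else 0 := by
  induction m generalizing j with
  | zero =>
    rw [pow_zero, one_apply]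
    simp only [colDeg, colCoef, Fin.ext_iff, hi]
    split_ifs <;> first | rfl | omega
  | succ m ih =>
    rw [pow_succ, mul_apply]
    simp only [ih, regNilp_apply hn]
    have hj := j.isLt
    by_cases h0 : (j : ℕ) = 0
    · rw [Finset.sum_eq_zero, if_neg]
      · rw [colDeg_of_lt (by omega)]; omega
      · intro k _
        rw [if_neg (show ¬ (_ ∨ _) by omega), mul_zero]
    by_cases h2 : (j : ℕ) = n + 1
    · -- The column `n + 2` of `Λ` has two nonzero entries.
      rw [Finset.sum_eq_add (⟨n - 1, by omega⟩ : Fin (2 * n)) ⟨n, by omega⟩]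
      · rw [if_pos (show _ ∨ _ by simp only; omega), if_pos (show _ ∨ _ by simp only; omega),
          h2, colDeg_of_lt (show n - 1 < n by omega), colDeg_of_ge le_rfl,
          colDeg_of_ge (by omega), colCoef_of_le (show n - 1 ≤ n by omega), colCoef_of_le le_rfl,
          colCoef_of_gt (by omega), mul_one, mul_one]
        by_cases hm : m + 1 = n
        · rw [if_pos (by omega), if_pos (by omega), if_pos (by omega)]; norm_num
        · rw [if_neg (by omega), if_neg (by omega), if_neg (by omega), add_zero]
      · rw [Ne, Fin.ext_iff]; simp only; omega
      · rintro k _ ⟨hk, hk'⟩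
        rw [Ne, Fin.ext_iff] at hk hk'
        rw [if_neg (show ¬ (_ ∨ _) by simp only at hk hk'; omega), mul_zero]
      · simp
      · simp
    · -- Every other column has a single nonzero entry, in the row `b`.
      obtain ⟨b, hb, hb', hbj⟩ : ∃ b < 2 * n,
          ((b + 1 = j ∧ b + 1 ≠ n) ∨ (b + 2 = n ∧ (j : ℕ) = n)) ∧
          colDeg n (j + 1) = colDeg n (b + 1) + 1 ∧ colCoef n (j + 1) = colCoef n (b + 1) := by
        by_cases h1 : (j : ℕ) = n
        · refine ⟨n - 2, by omega, by omega, ?_, ?_⟩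
          · rw [colDeg_of_ge (by omega), colDeg_of_lt (by omega)]; omega
          · rw [colCoef_of_le (by omega), colCoef_of_le (by omega)]
        · refine ⟨j - 1, by omega, by omega, ?_⟩
          by_cases hlt : (j : ℕ) < n
          · rw [colDeg_of_lt hlt, colDeg_of_lt (by omega), colCoef_of_le (by omega),
              colCoef_of_le (by omega)]
            exact ⟨by omega, rfl⟩
          · rw [colDeg_of_ge (by omega), colDeg_of_ge (by omega), colCoef_of_gt (by omega),
              colCoef_of_gt (by omega)]
            exact ⟨by omega, rfl⟩
      rw [Finset.sum_eq_single (⟨b, hb⟩ : Fin (2 * n))]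
      · rw [if_pos (show _ ∨ _ by simp only; omega), hbj.1, hbj.2, mul_one]
        refine if_congr ?_ rfl rfl
        push_cast
        omega
      · intro k _ hk
        rw [Ne, Fin.ext_iff] at hk
        rw [if_neg (show ¬ (_ ∨ _) by simp only at hk; omega), mul_zero]
      · simp

/-- The row `i ≤ n - 2` of a power of `Λ`, which is the first row of a higher power because
`e_iᵀ = e₁ᵀ Λ^(i-1)`. -/
theorem regNilp_pow_apply {n : ℕ} (hn : 2 ≤ n) (m : ℕ) (i j : Fin (2 * n)) (hi : (i : ℕ) + 3 ≤ n) :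
    (regNilp n ^ m) i j = if (m : ℤ) + i = colDeg n (j + 1) then colCoef n (j + 1) else 0 := by
  have key := regNilp_pow_zero_apply hn (i + m) ⟨0, by omega⟩ j rfl
  rw [pow_add, mul_apply, Finset.sum_eq_single i] at key
  · rw [regNilp_pow_zero_apply hn _ _ _ rfl, if_pos, colCoef, if_neg (by omega), one_mul] at key
    · rw [key]; push_cast; rw [add_comm]
    · rw [colDeg_of_lt (by omega)]
  · intro k _ hk
    rw [Ne, Fin.ext_iff] at hk
    rw [regNilp_pow_zero_apply hn _ _ _ rfl, if_neg, zero_mul]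
    by_cases hkn : (k : ℕ) < n
    · rw [colDeg_of_lt hkn]; omega
    · rw [colDeg_of_ge (by omega)]; omega
  · simp

/-! ### The coPfaffian matrix -/

theorem formMatrix_apply {n : ℕ} (i j : Fin (2 * n)) :
    formMatrix n i j =
      if (i : ℕ) + j + 1 = 2 * n then (-1) ^ (if (i : ℕ) < n then (i : ℕ) + 1 else (j : ℕ) + 1)
      else 0 := by
  have hi := i.isLt
  have hj := j.isLt
  have h : ∀ a ∈ Finset.Icc 1 n,
      ((-1 : ℂ) ^ a • (matUnit n a (2 * n + 1 - a) + matUnit n (2 * n + 1 - a) a)) i j =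
      if a = (if (i : ℕ) < n then (i : ℕ) + 1 else (j : ℕ) + 1) then
        (if (i : ℕ) + j + 1 = 2 * n then (-1) ^ a else 0) else 0 := by
    intro a ha
    rw [Finset.mem_Icc] at ha
    simp only [matUnit, Matrix.smul_apply, Matrix.add_apply, of_apply, smul_eq_mul]
    split_ifs <;> first | omega | simp
  rw [formMatrix, Matrix.sum_apply, Finset.sum_congr rfl h, Finset.sum_ite_eq']
  simp only [Finset.mem_Icc]
  split_ifs <;> first | rfl | omega

theorem formMatrix_mul_apply {n : ℕ} (A : Matrix (Fin (2 * n)) (Fin (2 * n)) ℂ)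
    (i j : Fin (2 * n)) :
    (formMatrix n * A) i j =
      (-1) ^ (if (i : ℕ) < n then (i : ℕ) + 1 else 2 * n - i) * A i.rev j := by
  have hi := i.isLt
  rw [mul_apply, Finset.sum_eq_single i.rev]
  · rw [formMatrix_apply, if_pos (by simp only [Fin.val_rev]; omega)]
    congr 2
    simp only [Fin.val_rev]
    split_ifs <;> omega
  · intro k _ hk
    rw [Ne, Fin.ext_iff, Fin.val_rev] at hk
    rw [formMatrix_apply, if_neg (by omega), zero_mul]
  · simp

/-- The nonzero entries of `S Λ`. As the weighted adjacency matrix of a graph on `1, …, 2n` it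
has the edges `{i, 2n+2-i}` for `2 ≤ i ≤ n` and `{n+1, n+2}`. -/
theorem formMatrix_mul_regNilp_apply {n : ℕ} (hn : 2 ≤ n) (i j : Fin (2 * n)) :
    (formMatrix n * regNilp n) i j =
      if ((i : ℕ) + j = 2 * n ∧ (i : ℕ) ≠ n) ∨
          ((i : ℕ) + j = 2 * n + 1 ∧ ((i : ℕ) = n + 1 ∨ (i : ℕ) = n)) then
        (-1) ^ (if (i : ℕ) < n then (i : ℕ) + 1 else 2 * n - i) else 0 := by
  have hi := i.isLt
  rw [formMatrix_mul_apply, regNilp_apply hn]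
  simp only [Fin.val_rev]
  split_ifs <;> first | omega | simp

/-- A Pfaffian with a zero row and column vanishes. -/
theorem pfaffian_eq_zero_of_isolated : ∀ (m : ℕ) (A : Matrix (Fin (2 * m)) (Fin (2 * m)) ℂ)
    (k : Fin (2 * m)), (∀ a, A a k = 0) → (∀ a, A k a = 0) → pfaffian m A = 0
  | 0, _, k, _, _ => k.elim0
  | m + 1, A, k, hc, hr => by
    rw [pfaffian]
    refine Finset.sum_eq_zero fun j _ => ?_
    rcases Fin.eq_zero_or_eq_succ (n := 2 * m + 1) k with rfl | ⟨k', rfl⟩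
    · rw [hr, mul_zero, zero_mul]
    · by_cases hj : k' = j
      · subst hj
        rw [hc, mul_zero, zero_mul]
      · obtain ⟨a, rfl⟩ := Fin.exists_succAbove_eq hj
        rw [pfaffian_eq_zero_of_isolated m _ a, mul_zero]
        · intro b; exact hc _
        · intro b; exact hr _

/-- The Pfaffian of a matrix supported on the antidiagonal is the product of the entries above the
diagonal. -/
theorem pfaffian_antidiagonal : ∀ (m : ℕ) (A : Matrix (Fin (2 * m)) (Fin (2 * m)) ℂ) (f : ℕ → ℂ),
    (∀ a b : Fin (2 * m), (a : ℕ) + b + 1 ≠ 2 * m → A a b = 0) →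
    (∀ a b : Fin (2 * m), (a : ℕ) + b + 1 = 2 * m → (a : ℕ) < m → A a b = f a) →
    pfaffian m A = ∏ a ∈ Finset.range m, f a
  | 0, _, _, _, _ => by simp [pfaffian]
  | m + 1, A, f, h0, hf => by
    rw [pfaffian, Finset.sum_eq_single (Fin.last (2 * m)), Finset.prod_range_succ']
    · rw [pfaffian_antidiagonal m _ (fun a => f (a + 1)), mul_comm]
      · congr 1
        rw [Fin.val_last, pow_mul, neg_one_sq, one_pow, one_mul]
        refine hf _ _ ?_ ?_
        · simp; ring
        · simp
      · intro a b hab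
        refine h0 _ _ ?_
        simp; omega
      · intro a b hab ha
        refine (hf _ _ ?_ ?_).trans ?_
        · simp; omega
        · simp; omega
        · simp
    · intro j _ hj
      rw [h0, mul_zero, zero_mul]
      rw [Ne, Fin.ext_iff, Fin.val_last] at hj
      simp; omega
    · simp

theorem exists_skipTwo_eq {n : ℕ} {i j k : Fin (2 * n)} (hij : i < j) (hi : k ≠ i) (hj : k ≠ j) :
    ∃ a, skipTwo n i j a = k := by
  rw [Ne, Fin.ext_iff] at hi hj
  rw [Fin.lt_def] at hij
  have := j.isLt
  have := k.isLt
  refine ⟨⟨if (k : ℕ) < i then k else if (k : ℕ) < j then k - 1 else k - 2, ?_⟩, ?_⟩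
  · split_ifs <;> omega
  · rw [Fin.ext_iff]
    simp only [skipTwo]
    split_ifs <;> omega

theorem skipTwo_ne_left {n : ℕ} (i j : Fin (2 * n)) (a) : skipTwo n i j a ≠ i := by
  rw [Ne, Fin.ext_iff]
  simp only [skipTwo]
  split_ifs <;> omega

theorem skipTwo_ne_right {n : ℕ} {i j : Fin (2 * n)} (hij : i < j) (a) : skipTwo n i j a ≠ j := by
  rw [Fin.lt_def] at hij
  rw [Ne, Fin.ext_iff]
  simp only [skipTwo]
  split_ifs <;> omega

theorem coPfEntry_eq_zero_of_isolated {n : ℕ} (A : Matrix (Fin (2 * n)) (Fin (2 * n)) ℂ)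
    {i j : Fin (2 * n)} (hij : i < j) (k : Fin (2 * n)) (hi : k ≠ i) (hj : k ≠ j)
    (hc : ∀ a, a ≠ i → a ≠ j → A a k = 0) (hr : ∀ a, a ≠ i → a ≠ j → A k a = 0) :
    coPfEntry n A i j = 0 := by
  obtain ⟨b, hb⟩ := exists_skipTwo_eq hij hi hj
  rw [coPfEntry, pfaffian_eq_zero_of_isolated _ _ b, mul_zero]
  · intro a
    rw [submatrix_apply, hb]
    exact hc _ (skipTwo_ne_left i j a) (skipTwo_ne_right hij a)
  · intro a
    rw [submatrix_apply, hb]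
    exact hr _ (skipTwo_ne_left i j a) (skipTwo_ne_right hij a)

theorem prod_range_neg_one_pow (n : ℕ) (hn : 1 ≤ n) :
    ∏ a ∈ Finset.range (n - 1), (-1 : ℂ) ^ (a + 2) = normConst n := by
  obtain ⟨m, rfl⟩ := Nat.exists_eq_add_of_le' hn
  rw [Finset.prod_pow_eq_pow_sum, normConst, Nat.add_sub_cancel]
  have h : ∑ a ∈ Finset.range m, (a + 2) + 1 = (m + 1) * (m + 1 + 1) / 2 := by
    have h2 : (∑ a ∈ Finset.range m, (a + 2) + 1) * 2 = (m + 1) * (m + 1 + 1) := by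
      clear hn
      induction m with
      | zero => rfl
      | succ m ih => rw [Finset.sum_range_succ]; linarith
    omega
  rw [← h, pow_succ]; ring

theorem normConst_mul_self (n : ℕ) : normConst n * normConst n = 1 := by
  rw [normConst, neg_mul_neg, ← mul_pow]; simp

/-- The number `c_n` is the Pfaffian of `S Λ` with the first row and column and one of the two
middle ones removed: what remains is a perfect matching. -/
theorem coPfEntry_middle {n : ℕ} (hn : 3 ≤ n) (i j : Fin (2 * n)) (hi : (i : ℕ) = 0)
    (hj : (j : ℕ) + 1 = n ∨ (j : ℕ) = n) :
    coPfEntry n (formMatrix n * regNilp n) i j = (-1) ^ (j : ℕ) * normConst n := by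
  rw [coPfEntry, hi, zero_add, pfaffian_antidiagonal (n - 1) _ (fun a => (-1) ^ (a + 2)),
    prod_range_neg_one_pow n (by omega)]
  · intro a b hab
    rw [submatrix_apply, formMatrix_mul_regNilp_apply (by omega), if_neg]
    simp only [skipTwo]
    split_ifs <;> omega
  · intro a b hab ha
    rw [submatrix_apply, formMatrix_mul_regNilp_apply (by omega)]
    by_cases hmid : (skipTwo n i j a : ℕ) < n
    · rw [if_pos hmid, if_pos]
      · simp only [skipTwo] at hmid ⊢
        split_ifs at hmid ⊢ <;> first | omega | rfl
      · simp only [skipTwo] at hmid ⊢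
        split_ifs at hmid ⊢ <;> omega
    · rw [if_neg hmid, if_pos]
      · simp only [skipTwo] at hmid ⊢
        split_ifs at hmid ⊢ <;> first | omega | (congr 1; omega)
      · simp only [skipTwo] at hmid ⊢
        split_ifs at hmid ⊢ <;> omega

theorem coPfEntry_formMatrix_mul_regNilp {n : ℕ} (hn : 3 ≤ n) (i j : Fin (2 * n)) (hij : i < j) :
    coPfEntry n (formMatrix n * regNilp n) i j =
      if (i : ℕ) = 0 ∧ ((j : ℕ) + 1 = n ∨ (j : ℕ) = n) then (-1) ^ (j : ℕ) * normConst n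
      else 0 := by
  have hj := j.isLt
  rw [Fin.lt_def] at hij
  split_ifs with h
  · exact coPfEntry_middle hn i j h.1 h.2
  by_cases hi : (i : ℕ) = 0
  · -- The only possible neighbour of the vertex `2n + 2 - j` is the deleted vertex `j`.
    refine coPfEntry_eq_zero_of_isolated _ hij ⟨2 * n - j, by omega⟩ ?_ ?_ ?_ ?_
    · rw [Ne, Fin.ext_iff]; simp only; omega
    · rw [Ne, Fin.ext_iff]; simp only; omega
    all_goals
      intro a ha ha'
      rw [Ne, Fin.ext_iff] at ha ha'
      rw [formMatrix_mul_regNilp_apply (by omega), if_neg]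
      simp only
      omega
  · refine coPfEntry_eq_zero_of_isolated _ hij ⟨0, by omega⟩ ?_ ?_ ?_ ?_
    · rw [Ne, Fin.ext_iff]; simp only; omega
    · rw [Ne, Fin.ext_iff]; simp only; omega
    all_goals
      intro a ha ha'
      have := a.isLt
      rw [formMatrix_mul_regNilp_apply (by omega), if_neg]
      simp only
      omega

/-- The element `Ψ = c_n (\hat{SΛ})ᵀ S` of the centralizer of `Λ` that is not a polynomial
in `Λ`. -/
def copfElem (n : ℕ) : Matrix (Fin (2 * n)) (Fin (2 * n)) ℂ :=
  normConst n • ((coPf n (formMatrix n * regNilp n))ᵀ * formMatrix n)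

theorem copfElem_apply {n : ℕ} (hn : 3 ≤ n) (i j : Fin (2 * n)) :
    copfElem n i j =
      if (i : ℕ) = 0 then (if (j : ℕ) = n then 1 else if (j : ℕ) + 1 = n then -1 else 0)
      else if (j : ℕ) + 1 = 2 * n then
        (if (i : ℕ) + 1 = n then (-1) ^ n else if (i : ℕ) = n then -(-1) ^ n else 0)
      else 0 := by
  have hj := j.isLt
  have hi := i.isLt
  have hentry : copfElem n i j = normConst n * (coPf n (formMatrix n * regNilp n) j.rev i *
      (-1) ^ (if (j : ℕ) < n then (j : ℕ) + 1 else 2 * n - j)) := by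
    rw [copfElem, Matrix.smul_apply, smul_eq_mul, mul_apply, Finset.sum_eq_single j.rev,
      transpose_apply, formMatrix_apply, if_pos (by simp only [Fin.val_rev]; omega)]
    · congr 3
      simp only [Fin.val_rev]
      split_ifs <;> omega
    · intro k _ hk
      rw [Ne, Fin.ext_iff, Fin.val_rev] at hk
      rw [formMatrix_apply, if_neg (by omega), mul_zero]
    · simp
  have hc := normConst_mul_self n
  have hsq : ((-1 : ℂ) ^ n) * (-1) ^ n = 1 := by rw [← mul_pow]; simp
  have hn1 : (-1 : ℂ) ^ n = - (-1) ^ (n - 1) := by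
    obtain ⟨m, rfl⟩ := Nat.exists_eq_add_of_le' (show 1 ≤ n by omega)
    rw [pow_succ, Nat.add_sub_cancel]; ring
  rw [hentry, coPf, of_apply]
  rcases lt_trichotomy j.rev i with h | h | h
  · rw [if_pos h, coPfEntry_formMatrix_mul_regNilp hn _ _ h]
    rw [Fin.lt_def, Fin.val_rev] at h
    simp only [Fin.val_rev]
    by_cases hj1 : (j : ℕ) + 1 = 2 * n
    · rw [if_neg (show (i : ℕ) ≠ 0 by omega), if_pos hj1, if_neg (show ¬ (j : ℕ) < n by omega),
        show 2 * n - (j : ℕ) = 1 by omega]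
      by_cases h1 : (i : ℕ) + 1 = n
      · rw [if_pos (by omega), if_pos h1, hn1, show (i : ℕ) = n - 1 by omega]
        linear_combination (-(-1) ^ (n - 1)) * hc
      by_cases h2 : (i : ℕ) = n
      · rw [if_pos (by omega), if_neg h1, if_pos h2, h2]
        linear_combination (-(-1) ^ n) * hc
      · rw [if_neg (by omega), if_neg h1, if_neg h2, zero_mul, mul_zero]
    · rw [if_neg (by omega), if_neg (show (i : ℕ) ≠ 0 by omega), if_neg hj1, zero_mul, mul_zero]
  · rw [if_neg h.not_lt, if_neg h.not_gt, zero_mul, mul_zero]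
    rw [Fin.ext_iff, Fin.val_rev] at h
    split_ifs <;> first | rfl | omega
  · rw [if_neg h.not_gt, if_pos h, coPfEntry_formMatrix_mul_regNilp hn _ _ h]
    rw [Fin.lt_def, Fin.val_rev] at h
    simp only [Fin.val_rev]
    by_cases hi0 : (i : ℕ) = 0
    · rw [if_pos hi0]
      by_cases h1 : (j : ℕ) = n
      · rw [if_pos (by omega), if_pos h1, if_neg (by omega),
          show 2 * n - ((j : ℕ) + 1) = n - 1 by omega, show 2 * n - (j : ℕ) = n by omega]
        linear_combination (-(-1) ^ (n - 1) * (-1) ^ n) * hc - (-1) ^ n * hn1 + hsq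
      by_cases h2 : (j : ℕ) + 1 = n
      · rw [if_pos (by omega), if_neg h1, if_pos h2, if_pos (by omega), h2,
          show 2 * n - n = n by omega]
        linear_combination (-(-1) ^ n * (-1) ^ n) * hc - hsq
      · rw [if_neg (by omega), if_neg h1, if_neg h2, neg_zero, zero_mul, mul_zero]
    · rw [if_neg (by omega), if_neg hi0, if_neg (show (j : ℕ) + 1 ≠ 2 * n by omega), neg_zero,
        zero_mul, mul_zero]

/-! ### The exponential -/

theorem regNilp_mul_copfElem {n : ℕ} (hn : 3 ≤ n) : regNilp n * copfElem n = 0 := by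
  ext i j
  rw [mul_apply, Matrix.zero_apply]
  have hi := i.isLt
  by_cases hm : (i : ℕ) + 2 = n
  · -- The contributions of the two middle rows of `Ψ` cancel.
    rw [Finset.sum_eq_add (⟨n - 1, by omega⟩ : Fin (2 * n)) ⟨n, by omega⟩]
    · simp only [regNilp_apply (show 2 ≤ n by omega), copfElem_apply hn]
      rw [if_pos (show (i : ℕ) + 1 = n - 1 ∧ (i : ℕ) + 1 ≠ n ∨ _ by omega),
        if_pos (show _ ∨ (i : ℕ) + 2 = n ∧ (_ ∨ _) by omega),
        if_neg (show n - 1 ≠ 0 by omega), if_neg (show n ≠ 0 by omega),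
        if_pos (show n - 1 + 1 = n by omega), if_neg (show n + 1 ≠ n by omega), if_pos trivial]
      split_ifs <;> ring
    · rw [Ne, Fin.ext_iff]; simp only; omega
    · rintro k _ ⟨hk, hk'⟩
      rw [Ne, Fin.ext_iff] at hk hk'
      simp only at hk hk'
      rw [regNilp_apply (by omega), if_neg (by omega), zero_mul]
    · simp
    · simp
  · refine Finset.sum_eq_zero fun k _ => ?_
    rw [regNilp_apply (by omega)]
    split_ifs with h
    · rw [copfElem_apply hn, if_neg (by omega), if_neg (show (k : ℕ) + 1 ≠ n by omega),
        if_neg (show (k : ℕ) ≠ n by omega), ite_self, mul_zero]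
    · rw [zero_mul]

theorem copfElem_mul_regNilp {n : ℕ} (hn : 3 ≤ n) : copfElem n * regNilp n = 0 := by
  ext i j
  rw [mul_apply, Matrix.zero_apply]
  have hi := i.isLt
  have hj := j.isLt
  by_cases hm : (j : ℕ) = n + 1
  · -- The contributions of the two middle columns of `Ψ` cancel.
    rw [Finset.sum_eq_add (⟨n - 1, by omega⟩ : Fin (2 * n)) ⟨n, by omega⟩]
    · simp only [regNilp_apply (show 2 ≤ n by omega), copfElem_apply hn]
      rw [if_neg (show n - 1 ≠ n by omega), if_pos (show n - 1 + 1 = n by omega), if_pos trivial,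
        if_neg (show n - 1 + 1 ≠ 2 * n by omega), if_neg (show n + 1 ≠ 2 * n by omega),
        if_pos (show n - 1 + 1 = (j : ℕ) ∧ _ ∨ n - 1 + 2 = (j : ℕ) ∧ (_ ∨ _) by omega),
        if_pos (show n + 1 = (j : ℕ) ∧ n + 1 ≠ n ∨ _ by omega)]
      split_ifs <;> ring
    · rw [Ne, Fin.ext_iff]; simp only; omega
    · rintro k _ ⟨hk, hk'⟩
      rw [Ne, Fin.ext_iff] at hk hk'
      simp only at hk hk'
      rw [regNilp_apply (by omega), if_neg (by omega), mul_zero]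
    · simp
    · simp
  · refine Finset.sum_eq_zero fun k _ => ?_
    rw [regNilp_apply (by omega)]
    split_ifs with h
    · rw [copfElem_apply hn, if_neg (show (k : ℕ) ≠ n by omega),
        if_neg (show (k : ℕ) + 1 ≠ n by omega),
        if_neg (show (k : ℕ) + 1 ≠ 2 * n by omega), ite_self, zero_mul]
    · rw [mul_zero]

theorem copfElem_sq_apply {n : ℕ} (hn : 3 ≤ n) (i j : Fin (2 * n)) :
    (copfElem n ^ 2) i j =
      if (i : ℕ) = 0 ∧ (j : ℕ) + 1 = 2 * n then 2 * (-1) ^ (n + 1) else 0 := by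
  rw [sq, mul_apply]
  have hi := i.isLt
  have hj := j.isLt
  rw [Finset.sum_eq_add (⟨n - 1, by omega⟩ : Fin (2 * n)) ⟨n, by omega⟩]
  · simp only [copfElem_apply hn]
    rw [if_neg (show n - 1 ≠ n by omega), if_pos (show n - 1 + 1 = n by omega), if_pos trivial,
      if_neg (show n - 1 + 1 ≠ 2 * n by omega), if_neg (show n + 1 ≠ 2 * n by omega),
      if_neg (show n - 1 ≠ 0 by omega), if_neg (show n ≠ 0 by omega),
      if_neg (show n + 1 ≠ n by omega)]
    split_ifs <;> first | omega | ring
  · rw [Ne, Fin.ext_iff]; simp only; omega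
  · rintro k _ ⟨hk, hk'⟩
    rw [Ne, Fin.ext_iff] at hk hk'
    simp only at hk hk'
    rw [copfElem_apply hn, copfElem_apply hn k, if_neg (show (k : ℕ) ≠ n by omega),
        if_neg (show (k : ℕ) + 1 ≠ n by omega)]
    split_ifs <;> first | omega | ring
  · simp
  · simp

theorem copfElem_pow_three {n : ℕ} (hn : 3 ≤ n) : copfElem n ^ 3 = 0 := by
  ext i j
  rw [pow_succ, mul_apply, Matrix.zero_apply]
  have hi := i.isLt
  have hj := j.isLt
  refine Finset.sum_eq_zero fun k _ => ?_
  rw [copfElem_sq_apply hn]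
  split_ifs with h
  · rw [copfElem_apply hn, if_neg (by omega), if_neg (show (k : ℕ) + 1 ≠ n by omega),
        if_neg (show (k : ℕ) ≠ n by omega), ite_self, mul_zero]
  · rw [zero_mul]

theorem exp_eq_sum_of_pow_eq_zero {m : Type*} [Fintype m] [DecidableEq m] {A : Matrix m m ℂ} {N : ℕ}
    (hA : A ^ N = 0) :
    NormedSpace.exp A = ∑ k ∈ Finset.range N, ((k.factorial : ℂ)⁻¹) • A ^ k := by
  rw [NormedSpace.exp_eq_tsum ℂ]
  refine tsum_eq_sum fun k hk => ?_
  rw [Finset.mem_range, not_lt] at hk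
  rw [pow_eq_zero_of_le hk hA, smul_zero]

/-- The series `∑ t_{2k-1} z^{2k-1}`, as a polynomial. -/
noncomputable def timePoly (n : ℕ) (t : Fin (n - 1) → ℂ) : Polynomial ℂ :=
  ∑ k : Fin (n - 1), Polynomial.C (t k) * Polynomial.X ^ (2 * (k : ℕ) + 1)

theorem X_dvd_timePoly (n : ℕ) (t : Fin (n - 1) → ℂ) : Polynomial.X ∣ timePoly n t :=
  Finset.dvd_sum fun _ _ => Dvd.dvd.mul_left (dvd_pow_self _ (by omega)) _

theorem coeff_timePoly_pow_eq_zero {n : ℕ} (t : Fin (n - 1) → ℂ) {m d : ℕ} (h : m < d) :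
    (timePoly n t ^ d).coeff m = 0 :=
  Polynomial.X_pow_dvd_iff.mp (pow_dvd_pow_of_dvd (X_dvd_timePoly n t) d) m h

theorem aeval_timePoly (n : ℕ) (t : Fin (n - 1) → ℂ) :
    Polynomial.aeval (regNilp n) (timePoly n t) =
      ∑ k : Fin (n - 1), t k • regNilp n ^ (2 * (k : ℕ) + 1) := by
  simp [timePoly, map_sum, Algebra.smul_def]

/-- The polynomials `q_m`, by the exponential series cut off at any order `N > m`. -/
theorem qPoly_natCast (n : ℕ) (t : Fin (n - 1) → ℂ) {m N : ℕ} (h : m < N) :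
    qPoly n t m = ∑ d ∈ Finset.range N, ((d.factorial : ℂ)⁻¹) * (timePoly n t ^ d).coeff m := by
  have hP : (∑ k : Fin (n - 1), PowerSeries.C (t k) * PowerSeries.X ^ (2 * (k : ℕ) + 1) :
      PowerSeries ℂ) = (timePoly n t : PowerSeries ℂ) := by
    rw [timePoly, ← Polynomial.coeToPowerSeries.ringHom_apply, map_sum]
    simp
  have hs : PowerSeries.HasSubst (timePoly n t : PowerSeries ℂ) := by
    refine PowerSeries.HasSubst.of_constantCoeff_zero' ?_
    rw [← PowerSeries.coeff_zero_eq_constantCoeff_apply, Polynomial.coeff_coe]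
    simpa using coeff_timePoly_pow_eq_zero t (show 0 < 1 by omega)
  have hc : ∀ d, (PowerSeries.coeff d) (PowerSeries.exp ℂ) •
      (PowerSeries.coeff m) ((timePoly n t : PowerSeries ℂ) ^ d) =
      ((d.factorial : ℂ)⁻¹) * (timePoly n t ^ d).coeff m := by
    intro d
    rw [← Polynomial.coe_pow, Polynomial.coeff_coe, PowerSeries.coeff_exp]
    simp
  rw [qPoly, if_pos (by omega), Int.toNat_natCast, hP, PowerSeries.coeff_subst' hs]
  simp only [hc]
  refine finsum_eq_sum_of_support_subset _ fun d hd => ?_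
  rw [Finset.coe_range, Set.mem_Iio]
  by_contra hd'
  exact hd (by simp only; rw [coeff_timePoly_pow_eq_zero t (by omega), mul_zero])

theorem qPoly_of_neg (n : ℕ) (t : Fin (n - 1) → ℂ) {m : ℤ} (h : m < 0) : qPoly n t m = 0 :=
  if_neg (by omega)

theorem qPoly_zero (n : ℕ) (t : Fin (n - 1) → ℂ) : qPoly n t 0 = 1 := by
  have := qPoly_natCast n t (show 0 < 1 by omega)
  simpa using this

theorem exp_aeval_timePoly {n : ℕ} (hn : 2 ≤ n) (t : Fin (n - 1) → ℂ) :
    NormedSpace.exp (Polynomial.aeval (regNilp n) (timePoly n t)) =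
      ∑ m ∈ Finset.range (2 * n), qPoly n t m • regNilp n ^ m := by
  have hpow : ∀ d, Polynomial.aeval (regNilp n) (timePoly n t) ^ d =
      ∑ m ∈ Finset.range (2 * n), (timePoly n t ^ d).coeff m • regNilp n ^ m := by
    intro d
    rw [← map_pow, Polynomial.aeval_eq_sum_range'
      (show (timePoly n t ^ d).natDegree < max ((timePoly n t ^ d).natDegree + 1) (2 * n) by omega)]
    refine (Finset.sum_subset (Finset.range_mono (le_max_right _ _)) fun m _ hm => ?_).symm
    rw [Finset.mem_range, not_lt] at hm
    rw [regNilp_pow_eq_zero hn hm, smul_zero]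
  have hnil : Polynomial.aeval (regNilp n) (timePoly n t) ^ (2 * n) = 0 := by
    rw [hpow]
    refine Finset.sum_eq_zero fun m hm => ?_
    rw [coeff_timePoly_pow_eq_zero t (Finset.mem_range.mp hm), zero_smul]
  rw [exp_eq_sum_of_pow_eq_zero hnil]
  simp only [hpow, Finset.smul_sum, smul_smul]
  rw [Finset.sum_comm]
  refine Finset.sum_congr rfl fun m hm => ?_
  rw [← Finset.sum_smul, qPoly_natCast n t (Finset.mem_range.mp hm)]

theorem exp_smul_copfElem {n : ℕ} (hn : 3 ≤ n) (s : ℂ) :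
    NormedSpace.exp (s • copfElem n) = 1 + s • copfElem n + (s ^ 2 / 2) • copfElem n ^ 2 := by
  rw [exp_eq_sum_of_pow_eq_zero (N := 3) (by rw [smul_pow, copfElem_pow_three hn, smul_zero])]
  simp [Finset.sum_range_succ, smul_pow, smul_smul]
  congr 1; ring

/-- Since `Λ Ψ = Ψ Λ = 0`, the exponentials of the polynomial part and of the coPfaffian part
of `Θ` only share their constant term. -/
theorem exp_Theta {n : ℕ} (hn : 3 ≤ n) (t : Fin (n - 1) → ℂ) (s : ℂ) :
    NormedSpace.exp (Theta n t s) =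
      ∑ m ∈ Finset.range (2 * n), qPoly n t m • regNilp n ^ m
        + s • copfElem n + (s ^ 2 / 2) • copfElem n ^ 2 := by
  have hT : Theta n t s = Polynomial.aeval (regNilp n) (timePoly n t) + s • copfElem n := by
    rw [Theta, aeval_timePoly, copfElem, smul_smul]
  obtain ⟨P, hP⟩ := X_dvd_timePoly n t
  have hMΨ : Polynomial.aeval (regNilp n) (timePoly n t) * copfElem n = 0 := by
    rw [hP, mul_comm Polynomial.X P, map_mul, Polynomial.aeval_X, mul_assoc,
      regNilp_mul_copfElem hn, mul_zero]
  have hΨM : copfElem n * Polynomial.aeval (regNilp n) (timePoly n t) = 0 := by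
    rw [hP, map_mul, Polynomial.aeval_X, ← mul_assoc, copfElem_mul_regNilp hn, zero_mul]
  have hEΨ : (∑ m ∈ Finset.range (2 * n), qPoly n t m • regNilp n ^ m) * copfElem n =
      copfElem n := by
    rw [Finset.sum_mul, Finset.sum_eq_single_of_mem 0 (Finset.mem_range.mpr (by omega))]
    · rw [Nat.cast_zero, qPoly_zero, pow_zero, one_smul, one_mul]
    · intro m _ hm
      obtain ⟨k, rfl⟩ := Nat.exists_eq_succ_of_ne_zero hm
      rw [smul_mul_assoc, pow_succ, mul_assoc, regNilp_mul_copfElem hn, mul_zero, smul_zero]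
  rw [hT, Matrix.exp_add_of_commute, exp_aeval_timePoly (by omega), exp_smul_copfElem hn, mul_add,
    mul_add, mul_one, mul_smul_comm, mul_smul_comm, sq (copfElem n), ← mul_assoc, hEΨ]
  rw [commute_iff_eq, mul_smul_comm, smul_mul_assoc, hMΨ, hΨM]

/-- The rows `1, …, n - 2` of `exp Θ`; the row `i` is `(i : ℕ) + 1` in the numbering from `1`. -/
theorem exp_Theta_apply {n : ℕ} (hn : 3 ≤ n) (t : Fin (n - 1) → ℂ) (s : ℂ) (i j : Fin (2 * n))
    (hi : (i : ℕ) + 3 ≤ n) :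
    NormedSpace.exp (Theta n t s) i j =
      colCoef n (j + 1) * qPoly n t (colDeg n (j + 1) - i) +
      if (i : ℕ) = 0 then
        ((if (j : ℕ) + 1 = n + 1 then s else 0) - (if (j : ℕ) + 1 = n then s else 0) +
          if (j : ℕ) + 1 = 2 * n then (-1) ^ (n + 1) * s ^ 2 else 0)
      else 0 := by
  have hj := j.isLt
  have hE : (∑ m ∈ Finset.range (2 * n), qPoly n t m • regNilp n ^ m) i j =
      colCoef n (j + 1) * qPoly n t (colDeg n (j + 1) - i) := by
    rw [Matrix.sum_apply]
    simp only [Matrix.smul_apply, regNilp_pow_apply (show 2 ≤ n by omega) _ i j hi, smul_eq_mul]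
    by_cases hneg : colDeg n (j + 1) - i < 0
    · rw [qPoly_of_neg n t hneg, mul_zero]
      exact Finset.sum_eq_zero fun m _ => by rw [if_neg (by omega), mul_zero]
    · obtain ⟨d, hd⟩ := Int.eq_ofNat_of_zero_le (not_lt.mp hneg)
      have hd2 : d < 2 * n := by
        rcases lt_or_ge (j : ℕ) n with h | h
        · rw [colDeg_of_lt h] at hd; omega
        · rw [colDeg_of_ge h] at hd; omega
      rw [Finset.sum_eq_single_of_mem d (Finset.mem_range.mpr hd2), if_pos (by omega), hd, mul_comm]
      intro m _ hm
      rw [if_neg (by omega), mul_zero]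
  rw [exp_Theta hn, Matrix.add_apply, Matrix.add_apply, hE, Matrix.smul_apply, Matrix.smul_apply,
    copfElem_apply hn, copfElem_sq_apply hn, add_assoc]
  congr 1
  simp only [smul_eq_mul]
  by_cases h0 : (i : ℕ) = 0
  · simp only [h0, if_true, true_and]
    split_ifs <;> first | omega | ring
  · rw [if_neg h0, if_neg h0, if_neg (show (i : ℕ) + 1 ≠ n by omega),
      if_neg (show (i : ℕ) ≠ n by omega), ite_self, if_neg (fun h => h0 h.1)]
    ring

/-! ### Minors with Toeplitz-like columns and Schur functions -/

/-- The determinant `det (q_{d_k - i})` with rows `i = 0, …, m - 1` and columns `k`. -/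
noncomputable def colDet (n : ℕ) (t : Fin (n - 1) → ℂ) {m : ℕ} (d : Fin m → ℤ) : ℂ :=
  (Matrix.of fun i k : Fin m => qPoly n t (d k - (i : ℕ))).det

theorem colDet_eq_zero {n : ℕ} (t : Fin (n - 1) → ℂ) {m : ℕ} (d : Fin m → ℤ) {a b : Fin m}
    (hab : a ≠ b) (h : d a = d b) : colDet n t d = 0 :=
  det_zero_of_column_eq hab fun i => by rw [of_apply, of_apply, h]

/-- Padding a Jacobi–Trudi determinant by zero parts does not change it. -/
theorem det_jacobiTrudi_pad {Q : ℤ → ℂ} (h0 : Q 0 = 1) (hneg : ∀ m < 0, Q m = 0) {n l : ℕ}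
    (hl : l ≤ n) (μ : Fin l → ℤ) :
    (Matrix.of fun i j : Fin n =>
      Q ((if h : (i : ℕ) < l then μ ⟨i, h⟩ else 0) - (i : ℤ) + (j : ℤ))).det =
    (Matrix.of fun i j : Fin l => Q (μ i - (i : ℤ) + (j : ℤ))).det := by
  obtain ⟨m, rfl⟩ := Nat.exists_eq_add_of_le hl
  set M := Matrix.of fun i j : Fin (l + m) =>
    Q ((if h : (i : ℕ) < l then μ ⟨i, h⟩ else 0) - (i : ℤ) + (j : ℤ)) with hM
  have hblock : M.submatrix finSumFinEquiv finSumFinEquiv =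
      fromBlocks (Matrix.of fun i j : Fin l => Q (μ i - (i : ℤ) + (j : ℤ)))
        (Matrix.of fun (i : Fin l) (j : Fin m) => Q (μ i - (i : ℤ) + (l + j : ℤ))) 0
        (Matrix.of fun i j : Fin m => Q ((j : ℤ) - (i : ℤ))) := by
    ext (i | i) (j | j)
    · simp [hM]
    · simp [hM]
    · simp only [hM, submatrix_apply, finSumFinEquiv_apply_right, finSumFinEquiv_apply_left,
        of_apply, fromBlocks_apply₂₁, Matrix.zero_apply, Fin.val_natAdd, Fin.val_castAdd]
      rw [dif_neg (by omega)]
      exact hneg _ (by have := j.isLt; push_cast; omega)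
    · simp only [hM, submatrix_apply, finSumFinEquiv_apply_right,
        of_apply, fromBlocks_apply₂₂, Fin.val_natAdd]
      rw [dif_neg (by omega)]
      congr 1
      push_cast
      ring
  rw [← det_submatrix_equiv_self finSumFinEquiv M, hblock, det_fromBlocks_zero₂₁]
  have hD : (Matrix.of fun i j : Fin m => Q ((j : ℤ) - (i : ℤ))).det = 1 := by
    rw [det_of_isUpperTriangular]
    · simp [h0]
    · intro i j hij
      refine hneg _ ?_
      have : (j : ℕ) < i := hij
      omega
  rw [hD, mul_one]

theorem schurS_eq_colDet {n l : ℕ} (hl : l ≤ n) (t : Fin (n - 1) → ℂ) (d μ : Fin l → ℤ)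
    (hμ : ∀ k, μ k = d k.rev - ((l : ℤ) - 1 - (k : ℕ))) : schurS n t μ = colDet n t d := by
  rw [schurS, det_jacobiTrudi_pad (qPoly_zero n t) (fun m hm => qPoly_of_neg n t hm) hl,
    ← det_transpose, ← det_submatrix_equiv_self Fin.revPerm, colDet]
  congr 1
  ext i k
  simp only [submatrix_apply, transpose_apply, of_apply, Fin.revPerm_apply, hμ, Fin.rev_rev,
    Fin.val_rev]
  congr 1
  have := i.isLt
  have := k.isLt
  omega

theorem lam_eq {n r : ℕ} (J : Fin r → ℕ) (k : Fin r) :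
    lam n r J k = colDeg n (J k.rev) - ((r : ℤ) - 1 - (k : ℕ)) := by
  rw [lam, colDeg]; ring

theorem schurS_lam {n r : ℕ} (hr : r ≤ n) (t : Fin (n - 1) → ℂ) (J : Fin r → ℕ) :
    schurS n t (lam n r J) = colDet n t fun k => colDeg n (J k) :=
  schurS_eq_colDet hr t _ _ fun k => lam_eq J k

/-- Removing the first row and the column `k₀` of the minor removes the part of `λ` that belongs
to `k₀` and shifts the later ones; columns and parts are in opposite orders. -/
theorem schurS_dropAt_lam {n l : ℕ} (hl : l + 1 ≤ n) (t : Fin (n - 1) → ℂ) (J : Fin (l + 1) → ℕ)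
    (k₀ : Fin (l + 1)) {p : ℕ} (hp : p = l - k₀) :
    schurS n t (dropAt p (lam n (l + 1) J)) =
      colDet n t fun a => colDeg n (J (k₀.succAbove a)) - 1 := by
  refine schurS_eq_colDet (l := l) (by omega) t _ _ fun (k : Fin l) => ?_
  have hk := k.isLt
  have hk₀ := k₀.isLt
  subst hp
  rw [dropAt]
  split_ifs with h
  · rw [lam_eq]
    have : (⟨(k : ℕ), by omega⟩ : Fin (l + 1)).rev = k₀.succAbove k.rev := by
      rw [Fin.succAbove_of_le_castSucc _ _ (by rw [Fin.le_def]; simp; omega), Fin.ext_iff]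
      simp; omega
    rw [this]
    push_cast
    ring
  · rw [lam_eq]
    have : (⟨(k : ℕ) + 1, by omega⟩ : Fin (l + 1)).rev = k₀.succAbove k.rev := by
      rw [Fin.succAbove_of_castSucc_lt _ _ (by rw [Fin.lt_def]; simp; omega), Fin.ext_iff]
      simp
    rw [this]
    push_cast
    ring

/-! ### The matrix coefficient as a minor -/

theorem stdVec_eq_single {n a : ℕ} (h1 : 1 ≤ a) (h2 : a ≤ 2 * n) :
    stdVec n a = Pi.single (⟨a - 1, by omega⟩ : Fin (2 * n)) 1 := by
  ext i
  simp only [stdVec, Pi.single_apply, Fin.ext_iff]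
  split_ifs <;> first | rfl | omega

theorem tau_eq_det {n r : ℕ} (hrn : r ≤ n) (J : Fin r → ℕ) (h1 : ∀ k, 1 ≤ J k)
    (h2 : ∀ k, J k ≤ 2 * n) (t : Fin (n - 1) → ℂ) (s : ℂ) :
    tau n r t s (wedgeVec n r J) =
      (Matrix.of fun i k : Fin r => NormedSpace.exp (Theta n t s)
        (⟨i, by omega⟩ : Fin (2 * n)) ⟨J k - 1, by have := h1 k; have := h2 k; omega⟩).det := by
  rw [tau, wedgeVec, wedgeVec, exteriorPower.map_apply_ιMulti, extForm_wedge]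
  congr 1
  ext i k
  rw [of_apply, of_apply, Function.comp_apply, stdVec_eq_single (by omega) (by omega),
    stdVec_eq_single (h1 k) (h2 k), toLin'_apply, mulVec_single_one, single_one_dotProduct]
  rfl

/-- The cofactor of the entry `(1, k)` in the minor of the rows `1, …, l + 1` and the columns `J`
of `exp Θ`. -/
noncomputable def minorCofactor (n : ℕ) (t : Fin (n - 1) → ℂ) {l : ℕ} (J : Fin (l + 1) → ℕ)
    (k : Fin (l + 1)) : ℂ :=
  (-1) ^ (k : ℕ) * ((∏ a, colCoef n (J (k.succAbove a))) *
    colDet n t fun a => colDeg n (J (k.succAbove a)) - 1)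

/-- The sum of the cofactors over the columns numbered `c`; it has at most one term. -/
noncomputable def cofactorAt (n : ℕ) (t : Fin (n - 1) → ℂ) {l : ℕ} (J : Fin (l + 1) → ℕ)
    (c : ℕ) : ℂ :=
  ∑ k, if J k = c then minorCofactor n t J k else 0

theorem cofactorAt_eq_zero {n : ℕ} (t : Fin (n - 1) → ℂ) {l : ℕ} (J : Fin (l + 1) → ℕ) {c : ℕ}
    (h : ∀ k, J k ≠ c) : cofactorAt n t J c = 0 :=
  Finset.sum_eq_zero fun k _ => if_neg (h k)

theorem cofactorAt_eq {n : ℕ} (t : Fin (n - 1) → ℂ) {l : ℕ} {J : Fin (l + 1) → ℕ}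
    (hJ : StrictMono J) {c : ℕ} {k₀ : Fin (l + 1)} (h : J k₀ = c) :
    cofactorAt n t J c = minorCofactor n t J k₀ := by
  rw [cofactorAt, Finset.sum_eq_single k₀, if_pos h]
  · intro k _ hk
    exact if_neg fun h' => hk (hJ.injective (h'.trans h.symm))
  · simp

theorem prod_colCoef (n : ℕ) {r : ℕ} (J : Fin r → ℕ) :
    ∏ k, colCoef n (J k) = 2 ^ numLarge n r J := by
  simp only [colCoef, numLarge]
  rw [Finset.prod_ite]
  simp

/-- Only the first row of the minor involves `s`, so the minor is linear in that perturbation. -/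
theorem tau_eq_add_cofactorAt {n l : ℕ} (hln : l + 3 ≤ n) (J : Fin (l + 1) → ℕ) (h1 : ∀ k, 1 ≤ J k)
    (h2 : ∀ k, J k ≤ 2 * n) (t : Fin (n - 1) → ℂ) (s : ℂ) :
    tau n (l + 1) t s (wedgeVec n (l + 1) J) =
      2 ^ numLarge n (l + 1) J * schurS n t (lam n (l + 1) J)
        + s * (cofactorAt n t J (n + 1) - cofactorAt n t J n)
        + (-1) ^ (n + 1) * s ^ 2 * cofactorAt n t J (2 * n) := by
  set B : Matrix (Fin (l + 1)) (Fin (l + 1)) ℂ :=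
    Matrix.of fun i k => colCoef n (J k) * qPoly n t (colDeg n (J k) - (i : ℕ)) with hB
  set v : Fin (l + 1) → ℂ := fun k =>
    (if J k = n + 1 then s else 0) - (if J k = n then s else 0) +
      if J k = 2 * n then (-1) ^ (n + 1) * s ^ 2 else 0 with hv
  have hmat : (Matrix.of fun i k : Fin (l + 1) => NormedSpace.exp (Theta n t s)
        (⟨i, by omega⟩ : Fin (2 * n)) ⟨J k - 1, by have := h1 k; have := h2 k; omega⟩) =
      B.updateRow 0 (B 0 + v) := by
    ext i k
    rw [of_apply, exp_Theta_apply (by omega) _ _ _ _ (by simp only; omega)]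
    simp only [Nat.sub_add_cancel (h1 k)]
    by_cases hi : i = 0
    · subst hi
      simp [hB, hv]
    · rw [updateRow_ne hi, if_neg (by rwa [← Fin.val_eq_zero_iff] at hi), add_zero, hB, of_apply]
  have hminor : ∀ k : Fin (l + 1),
      ((B.updateRow 0 v).submatrix Fin.succ k.succAbove).det =
      (∏ a, colCoef n (J (k.succAbove a))) *
        colDet n t fun a => colDeg n (J (k.succAbove a)) - 1 := by
    intro k
    rw [colDet, ← det_mul_row]
    congr 1
    ext i a
    rw [submatrix_apply, updateRow_ne (Fin.succ_ne_zero i), hB, of_apply, of_apply, of_apply,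
      Fin.val_succ]
    congr 2
    push_cast
    ring
  rw [tau_eq_det (by omega) J h1 h2, hmat, det_updateRow_add, updateRow_eq_self, add_assoc]
  congr 1
  · rw [schurS_lam (by omega), colDet, ← prod_colCoef, ← det_mul_row]
    rfl
  · rw [det_succ_row_zero]
    simp only [hminor, updateRow_self, cofactorAt, ← Finset.sum_sub_distrib, Finset.mul_sum,
      ← Finset.sum_add_distrib]
    refine Finset.sum_congr rfl fun k _ => ?_
    simp only [hv, minorCofactor]
    split_ifs <;> ring

/-! ### The cofactors in terms of Schur functions -/

theorem numLarge_eq {n l : ℕ} {J : Fin (l + 1) → ℕ} {k₀ : Fin (l + 1)}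
    (h : ∀ k, n + 2 ≤ J k ↔ k₀ < k) : numLarge n (l + 1) J = l - k₀ := by
  rw [numLarge]
  simp only [h]
  rw [Finset.filter_lt_eq_Ioi, Fin.card_Ioi]
  omega

theorem prod_colCoef_succAbove {n l : ℕ} {J : Fin (l + 1) → ℕ} {k₀ : Fin (l + 1)}
    (h : J k₀ ≤ n + 1) : ∏ a, colCoef n (J (k₀.succAbove a)) = 2 ^ numLarge n (l + 1) J := by
  rw [← prod_colCoef, Fin.prod_univ_succAbove _ k₀, colCoef, if_neg (by omega), one_mul]

theorem minorCofactor_of_numLarge {n l : ℕ} (hl : l + 1 ≤ n) (t : Fin (n - 1) → ℂ)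
    {J : Fin (l + 1) → ℕ} {k₀ : Fin (l + 1)} (hk₀ : J k₀ ≤ n + 1)
    (h : ∀ k, n + 2 ≤ J k ↔ k₀ < k) {p : ℕ} (hp : p = numLarge n (l + 1) J) :
    minorCofactor n t J k₀ =
      (-1) ^ (l + 1 - p + 1) * 2 ^ p * schurS n t (dropAt p (lam n (l + 1) J)) := by
  have hp' := hp.trans (numLarge_eq h)
  rw [minorCofactor, schurS_dropAt_lam hl t J k₀ hp', prod_colCoef_succAbove hk₀, ← hp,
    show l + 1 - p + 1 = (k₀ : ℕ) + 2 by have := k₀.isLt; omega]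
  ring

theorem cofactorAt_succ {n l : ℕ} (hl : l + 1 ≤ n) (t : Fin (n - 1) → ℂ)
    {J : Fin (l + 1) → ℕ} (hJ : StrictMono J) (h : ∃ k, J k = n + 1)
    {p : ℕ} (hp : p = numLarge n (l + 1) J) :
    cofactorAt n t J (n + 1) =
      (-1) ^ (l + 1 - p + 1) * 2 ^ p * schurS n t (dropAt p (lam n (l + 1) J)) := by
  obtain ⟨k₀, hk₀⟩ := h
  rw [cofactorAt_eq t hJ hk₀, minorCofactor_of_numLarge hl t hk₀.le (fun k => ?_) hp]
  rw [← hJ.lt_iff_lt, hk₀]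
  omega

theorem cofactorAt_self {n l : ℕ} (hl : l + 1 ≤ n) (t : Fin (n - 1) → ℂ)
    {J : Fin (l + 1) → ℕ} (hJ : StrictMono J) (h : ∃ k, J k = n) (h' : ∀ k, J k ≠ n + 1)
    {p : ℕ} (hp : p = numLarge n (l + 1) J) :
    cofactorAt n t J n =
      (-1) ^ (l + 1 - p + 1) * 2 ^ p * schurS n t (dropAt p (lam n (l + 1) J)) := by
  obtain ⟨k₀, hk₀⟩ := h
  rw [cofactorAt_eq t hJ hk₀, minorCofactor_of_numLarge hl t (by omega) (fun k => ?_) hp]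
  rw [← hJ.lt_iff_lt, hk₀]
  have := h' k
  omega

/-- The columns `n` and `n + 1` are adjacent and agree outside the first row, so their cofactors
are opposite. -/
theorem cofactorAt_self_eq_neg {n l : ℕ} (t : Fin (n - 1) → ℂ) {J : Fin (l + 1) → ℕ}
    (hJ : StrictMono J) (h : ∃ k, J k = n) (h' : ∃ k, J k = n + 1) :
    cofactorAt n t J n = -cofactorAt n t J (n + 1) := by
  obtain ⟨k₁, h₁⟩ := h
  obtain ⟨k₂, h₂⟩ := h'
  have hlt : k₁ < k₂ := by rw [← hJ.lt_iff_lt]; omega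
  have hadj : (k₂ : ℕ) = k₁ + 1 := by
    rw [Fin.lt_def] at hlt
    by_contra hne
    have ha : J k₁ < J ⟨k₁ + 1, by omega⟩ := hJ (by rw [Fin.lt_def]; simp)
    have hb : J ⟨k₁ + 1, by omega⟩ < J k₂ := hJ (by rw [Fin.lt_def]; simp only; omega)
    omega
  rw [cofactorAt_eq t hJ h₁, cofactorAt_eq t hJ h₂, minorCofactor, minorCofactor,
    prod_colCoef_succAbove (by omega), prod_colCoef_succAbove (by omega), hadj, pow_succ]
  have hd : (fun a => colDeg n (J (k₁.succAbove a)) - 1) =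
      fun a => colDeg n (J (k₂.succAbove a)) - 1 := by
    funext a
    rcases lt_trichotomy (a : ℕ) k₁ with ha | ha | ha
    · rw [Fin.succAbove_of_castSucc_lt _ _ (by rw [Fin.lt_def]; simpa),
        Fin.succAbove_of_castSucc_lt _ _ (by rw [Fin.lt_def]; simp; omega)]
    · rw [Fin.succAbove_of_le_castSucc _ _ (by rw [Fin.le_def]; simp; omega),
        Fin.succAbove_of_castSucc_lt _ _ (by rw [Fin.lt_def]; simp; omega),
        show a.succ = k₂ by ext; simp; omega, show a.castSucc = k₁ by ext; simpa, h₁, h₂]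
      simp [colDeg]
    · rw [Fin.succAbove_of_le_castSucc _ _ (by rw [Fin.le_def]; simp; omega),
        Fin.succAbove_of_le_castSucc _ _ (by rw [Fin.le_def]; simp; omega)]
  rw [hd]
  ring

theorem colDeg_succ_eq (n : ℕ) : colDeg n (n + 1) = colDeg n n := by simp [colDeg]

theorem schurS_lam_eq_zero {n l : ℕ} (hl : l + 1 ≤ n) (t : Fin (n - 1) → ℂ)
    {J : Fin (l + 1) → ℕ} (h : ∃ k, J k = n) (h' : ∃ k, J k = n + 1) :
    schurS n t (lam n (l + 1) J) = 0 := by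
  obtain ⟨k₁, h₁⟩ := h
  obtain ⟨k₂, h₂⟩ := h'
  rw [schurS_lam hl]
  refine colDet_eq_zero t _ (a := k₁) (b := k₂) (by rintro rfl; omega) ?_
  rw [h₁, h₂, colDeg_succ_eq]

theorem cofactorAt_last_eq_zero {n l : ℕ} (hn : 3 ≤ n) (t : Fin (n - 1) → ℂ)
    {J : Fin (l + 1) → ℕ} (h : ∃ k, J k = n) (h' : ∃ k, J k = n + 1) :
    cofactorAt n t J (2 * n) = 0 := by
  obtain ⟨k₁, h₁⟩ := h
  obtain ⟨k₂, h₂⟩ := h'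
  refine Finset.sum_eq_zero fun k _ => ?_
  split_ifs with hk
  · obtain ⟨a, ha⟩ := Fin.exists_succAbove_eq (x := k₁) (y := k) (by rintro rfl; omega)
    obtain ⟨b, hb⟩ := Fin.exists_succAbove_eq (x := k₂) (y := k) (by rintro rfl; omega)
    rw [minorCofactor, colDet_eq_zero t _ (a := a) (b := b), mul_zero, mul_zero]
    · rintro rfl
      have := ha.symm.trans hb
      subst this
      omega
    · rw [ha, hb, h₁, h₂, colDeg_succ_eq]
  · rfl

theorem cofactorAt_last {n l : ℕ} (hn : 3 ≤ n) (hl : l + 1 ≤ n) (t : Fin (n - 1) → ℂ)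
    {J : Fin (l + 1) → ℕ} (hJ : StrictMono J) (h2 : ∀ k, J k ≤ 2 * n) (h : ∃ k, J k = 2 * n)
    {p : ℕ} (hp : p = numLarge n (l + 1) J) :
    cofactorAt n t J (2 * n) =
      (-1) ^ l * 2 ^ (p - 1) * schurS n t (dropAt 0 (lam n (l + 1) J)) := by
  obtain ⟨k₀, hk₀⟩ := h
  have hlast : (k₀ : ℕ) = l := by
    by_contra hne
    have hlt : J k₀ < J (Fin.last l) := hJ (by
      have := k₀.isLt
      rw [Fin.lt_def, Fin.val_last]
      omega)
    have := h2 (Fin.last l)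
    omega
  have hpos : 1 ≤ p := by
    rw [hp, numLarge]
    exact Finset.card_pos.mpr ⟨k₀, by simp; omega⟩
  have hprod : ∏ a, colCoef n (J (k₀.succAbove a)) = 2 ^ (p - 1) := by
    have := prod_colCoef n J
    rw [Fin.prod_univ_succAbove _ k₀, ← hp, colCoef, if_pos (by omega),
      ← Nat.sub_add_cancel hpos, pow_succ, mul_comm] at this
    exact mul_right_cancel₀ two_ne_zero this
  rw [cofactorAt_eq t hJ hk₀, minorCofactor, schurS_dropAt_lam hl t J k₀ (by omega), hprod, hlast,
    mul_assoc]

end TypeDToda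

open TypeDToda in
theorem mainTheorem3 (n r : ℕ) (hr : 1 ≤ r) (hrn : r + 2 ≤ n)
    (J : Fin r → ℕ) (hJ : StrictMono J) (hJmem : ∀ k, J k ∈ Finset.Icc 1 (2 * n))
    (K : Finset ℕ) (hK : K = Finset.univ.image J ∩ {n, n + 1, 2 * n})
    (p : ℕ) (hp : p = numLarge n r J)
    (t : Fin (n - 1) → ℂ) (s : ℂ) :
    (K = ∅ →
      tau n r t s (wedgeVec n r J) = 2 ^ p * schurS n t (lam n r J)) ∧
    (K = {2 * n} →
      tau n r t s (wedgeVec n r J) =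
        2 ^ p * schurS n t (lam n r J)
        + (-1) ^ (n + r) * 2 ^ (p - 1) * s ^ 2 * schurS n t (dropAt 0 (lam n r J))) ∧
    (K = {n + 1} →
      tau n r t s (wedgeVec n r J) =
        2 ^ p * schurS n t (lam n r J)
        + (-1) ^ (r - p + 1) * 2 ^ p * s * schurS n t (dropAt p (lam n r J))) ∧
    (K = {n} →
      tau n r t s (wedgeVec n r J) =
        2 ^ p * schurS n t (lam n r J)
        + (-1) ^ (r - p) * 2 ^ p * s * schurS n t (dropAt p (lam n r J))) ∧
    (K = {n + 1, 2 * n} →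
      tau n r t s (wedgeVec n r J) =
        2 ^ p * schurS n t (lam n r J)
        + (-1) ^ (r - p + 1) * 2 ^ p * s * schurS n t (dropAt p (lam n r J))
        + (-1) ^ (n + r) * 2 ^ (p - 1) * s ^ 2 * schurS n t (dropAt 0 (lam n r J))) ∧
    (K = {n, 2 * n} →
      tau n r t s (wedgeVec n r J) =
        2 ^ p * schurS n t (lam n r J)
        + (-1) ^ (r - p) * 2 ^ p * s * schurS n t (dropAt p (lam n r J))
        + (-1) ^ (n + r) * 2 ^ (p - 1) * s ^ 2 * schurS n t (dropAt 0 (lam n r J))) ∧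
    (K = {n, n + 1} →
      tau n r t s (wedgeVec n r J) =
        (-1) ^ (r - p + 1) * 2 ^ (p + 1) * s * schurS n t (dropAt p (lam n r J))) ∧
    (K = {n, n + 1, 2 * n} →
      tau n r t s (wedgeVec n r J) =
        (-1) ^ (r - p + 1) * 2 ^ (p + 1) * s * schurS n t (dropAt p (lam n r J))) := by
  obtain ⟨l, rfl⟩ := Nat.exists_eq_add_of_le' hr
  have h1 : ∀ k, 1 ≤ J k := fun k => (Finset.mem_Icc.mp (hJmem k)).1
  have h2 : ∀ k, J k ≤ 2 * n := fun k => (Finset.mem_Icc.mp (hJmem k)).2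
  have hpr : p ≤ l + 1 := by
    rw [hp, numLarge]
    exact (Finset.card_filter_le _ _).trans_eq (Finset.card_fin _)
  have hmem : ∀ c ∈ ({n, n + 1, 2 * n} : Finset ℕ), (∃ k, J k = c) ↔ c ∈ K := by
    intro c hc
    rw [hK, Finset.mem_inter, and_iff_left hc]
    simp
  have memN := hmem n (by simp)
  have memN' := hmem (n + 1) (by simp)
  have memL := hmem (2 * n) (by simp)
  clear hmem hK
  have e1 : n ≠ n + 1 := by omega
  have e2 : n ≠ 2 * n := by omega
  have e3 : n + 1 ≠ 2 * n := by omega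
  have absent : ∀ {c}, ¬ (∃ k, J k = c) → cofactorAt n t J c = 0 := fun h =>
    cofactorAt_eq_zero t J fun k hk => h ⟨k, hk⟩
  have mid : (∃ k, J k = n + 1) → _ := fun h => cofactorAt_succ (by omega) t hJ h hp
  have self : (∃ k, J k = n) → ¬ (∃ k, J k = n + 1) → _ := fun h h' =>
    cofactorAt_self (by omega) t hJ h (fun k hk => h' ⟨k, hk⟩) hp
  have last : (∃ k, J k = 2 * n) → _ := fun h => cofactorAt_last (by omega) (by omega) t hJ h2 h hp
  rw [tau_eq_add_cofactorAt (by omega) J h1 h2, ← hp]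
  refine ⟨?_, ?_, ?_, ?_, ?_, ?_, ?_, ?_⟩ <;> intro hK <;>
    simp only [hK, Finset.notMem_empty, Finset.mem_insert, Finset.mem_singleton, e1, e2, e3,
      e1.symm, e2.symm, e3.symm, or_true, or_false, iff_true, iff_false]
      at memN memN' memL
  · rw [absent memN, absent memN', absent memL]
    ring
  · rw [absent memN, absent memN', last memL]
    ring
  · rw [absent memN, mid memN', absent memL]
    ring
  · rw [self memN memN', absent memN', absent memL]
    ring
  · rw [absent memN, mid memN', last memL]
    ring
  · rw [self memN memN', absent memN', last memL]
    ring
  · rw [cofactorAt_self_eq_neg t hJ memN memN', mid memN', absent memL,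
      schurS_lam_eq_zero (by omega) t memN memN']
    ring
  · rw [cofactorAt_self_eq_neg t hJ memN memN', mid memN',
      cofactorAt_last_eq_zero (by omega) t memN memN', schurS_lam_eq_zero (by omega) t memN memN']
    ring
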